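/- Let $\mathbb{K}$ be a field, $r\in\mathbb{N}$, and order $\mathbf{R}^r=(\mathbb{R}_{\ge 0})^r$ componentwise. A persistence module is a functor $M\colon \mathbf{R}^r\to \mathrm{Vect}_{\mathbb{K}}$ (equivalently, an $\mathbf{R}^r$-graded $\mathbb{K}[\mathbf{R}^r]$-module); it is tame if it is finitely presented. Let $\beta_0(M)$ denote the smallest rank of a free persistence module surjecting onto $M$. For $w\in\mathbf{R}^r$ let $\dim_w(M)$ be the smallest $k$ such that there are homogeneous elements $m_1,\dots,m_k$ of $M$ with $w*(M/\langle m_1,\dots,m_k\rangle)=0$, i.e. all maps $N(a\le a+w)$ of $N=M/\langle m_1,\dots,m_k\rangle$ vanish. Let $v,\alpha\in\mathbf{R}^r$ (for example with $v$ of norm $1$). The $\alpha$-truncated standard contour in the direction of $v$ is the function $C_\alpha\colon (\mathbf{R}^r\cup\{\infty\})\times\mathbb{R}_{\ge 0}\to \mathbf{R}^r\cup\{\infty\}$ given by $C_\alpha(x,\varepsilon)=x+\varepsilon v$ if $\alpha\not\le x+\varepsilon v$ and $C_\alpha(x,\varepsilon)=\infty$ otherwise. Its noise system is $\{\mathcal{V}_\varepsilon\}_{\varepsilon\ge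 0}$, where $\mathcal{V}_\varepsilon$ is the set of tame $N$ such that $N(x\le C_\alpha(x,\varepsilon))=0$ for all $x\in\mathbf{R}^r$ with $C_\alpha(x,\varepsilon)\ne\infty$. A morphism $f$ of tame modules is an $\varepsilon$-equivalence for this noise system if there are $\tau,\mu\ge 0$ with $\tau+\mu\le\varepsilon$, $\ker f\in\mathcal{V}_\tau$ and $\operatorname{coker} f\in\mathcal{V}_\mu$. Tame modules $M,N$ are $\varepsilon$-close if there are a tame $L$, an $\varepsilon_1$-equivalence $M\to L$ and an $\varepsilon_2$-equivalence $N\to L$ with $\varepsilon_1+\varepsilon_2\le\varepsilon$; let $d(M,N)\in[0,\infty]$ be the infimum of all such $\varepsilon$. The hierarchical stabilization of $\beta_0$ with respect to the $\alpha$-truncated noise in the direction of $v$ is $$\widehat{\beta_0}_{v,\alpha}(M)(\delta)=\min\{\beta_0(N)\mid N \text{ tame},\ d(M,N)\le\delta\}.$$ Then for every tame persistence module $M$ and every $\delta\ge 0$, $$\widehat{\beta_0}_{v,\alpha}(M)(\delta)=\dim_{\delta v}\Bigl(M\big/\bigoplus_{\beta\ge\alpha}M_\beta\Bigr).$$ 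-/

import Mathlib

open CategoryTheory
open scoped NNReal ENNReal

universe u

/-- The set `ℝ_{≥0}^r` of degrees, with the componentwise order. (A type synonym, so that its
category structure is the posetal one.) -/
def Deg (r : ℕ) : Type := Fin r → ℝ≥0

instance (r : ℕ) : PartialOrder (Deg r) := inferInstanceAs (PartialOrder (Fin r → ℝ≥0))

instance (r : ℕ) : AddCommMonoid (Deg r) := inferInstanceAs (AddCommMonoid (Fin r → ℝ≥0))

instance (r : ℕ) : Module ℝ≥0 (Deg r) := inferInstanceAs (Module ℝ≥0 (Fin r → ℝ≥0))

theorem Deg.le_add {r : ℕ} (a v : Deg r) : a ≤ a + v :=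
  fun _ => le_add_of_nonneg_right zero_le

/-- Multiparameter persistence modules over the field `K`. -/
abbrev PersMod (K : Type u) [Field K] (r : ℕ) : Type (u + 1) :=
  Deg r ⥤ ModuleCat.{u} K

/-! ### Free modules, tameness and the zeroth Betti number -/

/-- The free persistence module `⨁ᵢ K(dᵢ, •)`: its value at `h` has as a basis the indices `i` with
`dᵢ ≤ h`, and the structure maps are the inclusions. -/
noncomputable def freeMod (K : Type u) [Field K] {r n : ℕ} (d : Fin n → Deg r) : PersMod K r where
  obj h := ModuleCat.of K ({i : Fin n // d i ≤ h} →₀ K)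
  map {h h'} f := ModuleCat.ofHom (Finsupp.lmapDomain K K
    (fun i : {i : Fin n // d i ≤ h} =>
      (⟨i.1, i.2.trans (leOfHom f)⟩ : {i : Fin n // d i ≤ h'})))
  map_id h := by
    apply ModuleCat.hom_ext
    apply LinearMap.ext
    intro x
    exact Finsupp.mapDomain_id
  map_comp f g := by
    apply ModuleCat.hom_ext
    apply LinearMap.ext
    intro x
    exact Finsupp.mapDomain_comp (v := x)
      (f := fun i : {i : Fin n // d i ≤ _} => (⟨i.1, i.2.trans (leOfHom f)⟩ : {i // d i ≤ _}))
      (g := fun i : {i : Fin n // d i ≤ _} => (⟨i.1, i.2.trans (leOfHom g)⟩ : {i // d i ≤ _}))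

/-- Tame persistence modules: those with a finite presentation
`⨁ⱼ K(eⱼ, •) → ⨁ᵢ K(dᵢ, •) → M → 0`. -/
def IsTame {K : Type u} [Field K] {r : ℕ} (M : PersMod K r) : Prop :=
  ∃ (m n : ℕ) (e : Fin m → Deg r) (d : Fin n → Deg r)
    (q : freeMod K e ⟶ freeMod K d) (p : freeMod K d ⟶ M),
    ∀ a : Deg r, Function.Exact (q.app a) (p.app a) ∧ Function.Surjective (p.app a)

/-- Tame persistence modules, as a type. -/
abbrev TameMod (K : Type u) [Field K] (r : ℕ) : Type (u + 1) :=
  {M : PersMod K r // IsTame M}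

/-- The total zeroth multigraded Betti number: the smallest rank of a free module surjecting
onto `M`. -/
noncomputable def betti₀ {K : Type u} [Field K] {r : ℕ} (M : PersMod K r) : ℕ :=
  sInf {n : ℕ | ∃ (d : Fin n → Deg r) (p : freeMod K d ⟶ M),
    ∀ a : Deg r, Function.Surjective (p.app a)}

/-! ### Submodules, quotients and the shift-dimension -/

/-- Graded submodules (subfunctors) of a persistence module. -/
structure GrSub {K : Type u} [Field K] {r : ℕ} (M : PersMod K r) where
  /-- the homogeneous component of degree `a` -/
  comp : ∀ a : Deg r, Submodule K (M.obj a)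
  map_mem : ∀ {a b : Deg r} (f : a ⟶ b), comp a ≤ (comp b).comap (M.map f).hom

/-- The quotient `M / S` of a persistence module by a graded submodule. -/
noncomputable def GrSub.quotient {K : Type u} [Field K] {r : ℕ} {M : PersMod K r} (S : GrSub M) :
    PersMod K r where
  obj a := ModuleCat.of K (M.obj a ⧸ S.comp a)
  map {a b} f := ModuleCat.ofHom ((S.comp a).mapQ (S.comp b) (M.map f).hom (S.map_mem f))
  map_id a := by
    ext x
    simp
  map_comp f g := by
    ext x
    simp

/-- The graded submodule `⟨m₁, …, mₖ⟩` generated by homogeneous elements `mᵢ` of degrees `dᵢ`. -/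
def GrSub.generated {K : Type u} [Field K] {r : ℕ} (M : PersMod K r) {k : ℕ}
    (d : Fin k → Deg r) (m : ∀ i, M.obj (d i)) : GrSub M where
  comp b := Submodule.span K {x | ∃ (i : Fin k) (f : d i ⟶ b), x = (M.map f).hom (m i)}
  map_mem {a b} f := by
    rw [Submodule.span_le]
    rintro x ⟨i, g, rfl⟩
    exact Submodule.subset_span ⟨i, g ≫ f, by simp⟩

/-- The graded submodule `⨁_{β ≥ α} M_β`. -/
noncomputable def GrSub.above {K : Type u} [Field K] {r : ℕ} (M : PersMod K r) (α : Deg r) :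
    GrSub M where
  comp b := ⨆ _ : α ≤ b, ⊤
  map_mem {a b} f := iSup_le fun h => by
    rw [iSup_pos (h.trans (leOfHom f))]
    exact le_top

/-- `v * N = 0`, i.e. multiplication by `v` annihilates `N`. -/
def ShiftZero {K : Type u} [Field K] {r : ℕ} (v : Deg r) (N : PersMod K r) : Prop :=
  ∀ a : Deg r, N.map (homOfLE (Deg.le_add a v)) = 0

/-- The shift-dimension `dim_v M`: the smallest number of homogeneous elements `m₁, …, mₖ` of `M`
with `v * (M / ⟨m₁, …, mₖ⟩) = 0`. -/
noncomputable def shiftDim {K : Type u} [Field K] {r : ℕ} (v : Deg r) (M : PersMod K r) : ℕ :=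
  sInf {k : ℕ | ∃ (d : Fin k → Deg r) (m : ∀ i, M.obj (d i)),
    ShiftZero v (GrSub.generated M d m).quotient}

/-! ### Persistence contours -/

/-- Persistence contours `C : ℝ_{≥0}^r ∪ {∞} × ℝ_{≥0} → ℝ_{≥0}^r ∪ {∞}`. -/
structure Contour (r : ℕ) where
  toFun : WithTop (Deg r) → ℝ≥0 → WithTop (Deg r)
  mono : ∀ {x y : WithTop (Deg r)} {ε τ : ℝ≥0}, x ≤ y → ε ≤ τ → toFun x ε ≤ toFun y τ
  le : ∀ (x : WithTop (Deg r)) (ε : ℝ≥0), x ≤ toFun x ε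
  lax : ∀ (x : WithTop (Deg r)) (ε τ : ℝ≥0), toFun (toFun x ε) τ ≤ toFun x (ε + τ)

/-- The standard contour `C(x, ε) = x + ε v` in the direction of `v`. -/
def standardContour {r : ℕ} (v : Deg r) : Contour r where
  toFun x ε := WithTop.map (fun a : Deg r => a + ε • v) x
  mono {x y ε τ} hxy hε := by
    induction y with
    | top => simp
    | coe y =>
      induction x with
      | top => simp at hxy
      | coe x =>
        simp only [WithTop.map_coe, WithTop.coe_le_coe] at hxy ⊢
        exact fun i => add_le_add (hxy i) (mul_le_mul_left hε (v i))
  le x ε := by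
    induction x with
    | top => simp
    | coe x => exact WithTop.coe_le_coe.2 (Deg.le_add _ _)
  lax x ε τ := by
    induction x with
    | top => simp
    | coe x =>
      change ((x + ε • v + τ • v : Deg r) : WithTop (Deg r)) ≤ ((x + (ε + τ) • v : Deg r) : _)
      rw [add_smul, add_assoc]

open Classical in
/-- The truncation `C_α` of a contour `C` at `α`. -/
noncomputable def Contour.truncate {r : ℕ} (C : Contour r) (α : Deg r) : Contour r where
  toFun x ε := if ¬ (α : WithTop (Deg r)) ≤ C.toFun x ε then C.toFun x ε else ⊤
  mono {x y ε τ} hxy hε := by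
    have h := C.mono hxy hε
    by_cases hy : (α : WithTop (Deg r)) ≤ C.toFun y τ
    · simp [hy]
    · have hx : ¬ (α : WithTop (Deg r)) ≤ C.toFun x ε := fun hx => hy (hx.trans h)
      simpa [hx, hy] using h
  le x ε := by
    split_ifs
    · exact le_top
    · exact C.le x ε
  lax x ε τ := by
    by_cases hy : (α : WithTop (Deg r)) ≤ C.toFun x (ε + τ)
    · simp [hy]
    · have h := C.lax x ε τ
      have hx : ¬ (α : WithTop (Deg r)) ≤ C.toFun (C.toFun x ε) τ := fun hx => hy (hx.trans h)
      have hx' : ¬ (α : WithTop (Deg r)) ≤ C.toFun x ε :=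
        fun hx' => hx (hx'.trans (C.le _ _))
      simpa [hx, hx', hy] using h

/-! ### Noise systems, their pseudometrics and hierarchical stabilization -/

/-- The noise system `{𝒱_{C,ε}}_ε` of a contour `C`: the tame modules `M` for which
`M(x ≤ C(x, ε))` is zero whenever `C(x, ε) ≠ ∞`. -/
def Contour.noise (K : Type u) [Field K] {r : ℕ} (C : Contour r) (ε : ℝ≥0) : Set (PersMod K r) :=
  {M | IsTame M ∧ ∀ (x y : Deg r) (hxy : x ≤ y),
    C.toFun (x : WithTop (Deg r)) ε = (y : WithTop (Deg r)) → M.map (homOfLE hxy) = 0}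

/-- `f` is an `ε`-equivalence for the noise system `𝒱`: there are `τ + μ ≤ ε` with `ker f ∈ 𝒱_τ`
and `coker f ∈ 𝒱_μ`. -/
def NoiseEquivalence {K : Type u} [Field K] {r : ℕ} (V : ℝ≥0 → Set (PersMod K r)) (ε : ℝ≥0)
    {M N : PersMod K r} (f : M ⟶ N) : Prop :=
  ∃ τ μ : ℝ≥0, τ + μ ≤ ε ∧ Limits.kernel f ∈ V τ ∧ Limits.cokernel f ∈ V μ

/-- `M` and `N` are `ε`-close for the noise system `𝒱`: there are a tame `L` and morphisms
`M → L ← N` that are an `ε₁`- and an `ε₂`-equivalence with `ε₁ + ε₂ ≤ ε`. -/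
def NoiseClose {K : Type u} [Field K] {r : ℕ} (V : ℝ≥0 → Set (PersMod K r)) (ε : ℝ≥0)
    (M N : TameMod K r) : Prop :=
  ∃ (L : TameMod K r) (f : M.1 ⟶ L.1) (g : N.1 ⟶ L.1) (ε₁ ε₂ : ℝ≥0),
    NoiseEquivalence V ε₁ f ∧ NoiseEquivalence V ε₂ g ∧ ε₁ + ε₂ ≤ ε

/-- The extended pseudometric of a noise system: the infimum of all `ε` for which `M` and `N` are
`ε`-close, and `∞` if there is none. -/
noncomputable def noiseDist {K : Type u} [Field K] {r : ℕ} (V : ℝ≥0 → Set (PersMod K r))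
    (M N : TameMod K r) : ℝ≥0∞ :=
  ⨅ (ε : ℝ≥0) (_ : NoiseClose V ε M N), (ε : ℝ≥0∞)

/-- The hierarchical stabilization `f̂(x)(τ) = min {f(y) | d(x, y) ≤ τ}` of a discrete invariant. -/
noncomputable def hierarchicalStabilization {T : Type*} (d : T → T → ℝ≥0∞) (f : T → ℕ) (x : T)
    (τ : ℝ≥0) : ℕ :=
  sInf {n : ℕ | ∃ y : T, d x y ≤ (τ : ℝ≥0∞) ∧ f y = n}

/-! Two inequalities. For "≤", lift `k` elements generating `M / ⨁_{β ≥ α} M_β` up to `δ • v` to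
`M`, and let `N ⊆ M` be the submodule they generate. The inclusion `N → M` has zero kernel, and its
cokernel is killed by the shift by `δ • v` in all degrees that the shift does not bring above `α`,
which is membership in the truncated noise (`exists_noiseClose`).

For "≥", a cospan `M → L ← N` transports generators of `N` to `M`: their images in `L` lift to `M`
after a shift by the cokernel bound of `M → L`. Conversely the image in `L` of an element of `M`
lifts to `N` after a shift by the other cokernel bound, is written there in the generators and
returned to `M`; the error lies in the kernel of `M → L` and dies after one more shift. Truncation
is harmless, as degrees above `α` vanish in the quotient (`NoiseClose.exists_shiftZero`).

The distance is an infimum, so this argument only covers shifts by `ε • v` with `ε > δ`. Passing to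
`δ` is right continuity (`shiftDim_le_of_forall_gt`): a tame module is constant on the cells of a
finite grid, and a sufficiently small increase of `ε` does not change the cells reached from the
finitely many minimal points of cells. The grid description (`isTame_iff_gridConst`) also shows that
kernels and cokernels of tame modules are tame. -/

variable {K : Type u} [Field K] {r : ℕ}

/-! ### Structure maps, elementwise -/

/-- The structure map `M(a ≤ b)` as a linear map. -/
noncomputable def push (M : PersMod K r) {a b : Deg r} (h : a ≤ b) : M.obj a →ₗ[K] M.obj b :=
  (M.map (homOfLE h)).hom

theorem push_push (M : PersMod K r) {a b c : Deg r} (h : a ≤ b) (h' : b ≤ c) (x : M.obj a) :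
    push M h' (push M h x) = push M (h.trans h') x := by
  have e : M.map (homOfLE (h.trans h')) = M.map (homOfLE h) ≫ M.map (homOfLE h') := by
    rw [← M.map_comp]
    rfl
  simp [push, e]

theorem push_self (M : PersMod K r) {a : Deg r} (h : a ≤ a) (x : M.obj a) : push M h x = x := by
  have e : M.map (homOfLE h) = 𝟙 _ := by
    rw [← M.map_id]
    rfl
  simp [push]

theorem app_push {M N : PersMod K r} (f : M ⟶ N) {a b : Deg r} (h : a ≤ b) (x : M.obj a) :
    f.app b (push M h x) = push N h (f.app a x) :=
  NatTrans.naturality_apply f (homOfLE h) x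

theorem map_eq_zero_iff_push (M : PersMod K r) {a b : Deg r} (h : a ≤ b) :
    M.map (homOfLE h) = 0 ↔ ∀ x, push M h x = 0 := by
  refine ⟨fun e x => by simp [push, e], fun e => ?_⟩
  apply ModuleCat.hom_ext
  exact LinearMap.ext e

/-! ### Kernels and cokernels, pointwise -/

theorem exact_app {S : ShortComplex (PersMod K r)} (hS : S.Exact) (a : Deg r) :
    Function.Exact (S.f.app a) (S.g.app a) :=
  (ShortComplex.ShortExact.moduleCat_exact_iff_function_exact
    (S.map ((evaluation (Deg r) (ModuleCat.{u} K)).obj a))).1 (hS.map _)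

theorem kernel_ι_app_injective {M N : PersMod K r} (f : M ⟶ N) (a : Deg r) :
    Function.Injective ((Limits.kernel.ι f).app a) :=
  (ModuleCat.mono_iff_injective _).1 inferInstance

theorem cokernel_π_app_surjective {M N : PersMod K r} (f : M ⟶ N) (a : Deg r) :
    Function.Surjective ((Limits.cokernel.π f).app a) :=
  (ModuleCat.epi_iff_surjective _).1 inferInstance

theorem kernel_ι_app_exact {M N : PersMod K r} (f : M ⟶ N) (a : Deg r) :
    Function.Exact ((Limits.kernel.ι f).app a) (f.app a) :=
  exact_app (ShortComplex.exact_kernel f) a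

theorem cokernel_π_app_exact {M N : PersMod K r} (f : M ⟶ N) (a : Deg r) :
    Function.Exact (f.app a) ((Limits.cokernel.π f).app a) :=
  exact_app (ShortComplex.exact_cokernel f) a

/-! ### Free modules and generators -/

theorem generated_comp (M : PersMod K r) {k : ℕ} (d : Fin k → Deg r) (m : ∀ i, M.obj (d i))
    (b : Deg r) : (GrSub.generated M d m).comp b =
      Submodule.span K (Set.range fun i : {i : Fin k // d i ≤ b} => push M i.2 (m i.1)) := by
  change Submodule.span K _ = _
  congr 1
  ext x
  constructor
  · rintro ⟨i, f, rfl⟩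
    exact ⟨⟨i, leOfHom f⟩, rfl⟩
  · rintro ⟨i, rfl⟩
    exact ⟨i.1, homOfLE i.2, rfl⟩

theorem push_mem_generated (M : PersMod K r) {k : ℕ} (d : Fin k → Deg r)
    (m : ∀ i, M.obj (d i)) (i : Fin k) {b : Deg r} (h : d i ≤ b) :
    push M h (m i) ∈ (GrSub.generated M d m).comp b :=
  Submodule.subset_span ⟨i, homOfLE h, rfl⟩

theorem GrSub.push_mem {M : PersMod K r} (S : GrSub M) {a b : Deg r} (h : a ≤ b) {x : M.obj a}
    (hx : x ∈ S.comp a) : push M h x ∈ S.comp b :=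
  S.map_mem (homOfLE h) hx

/-- The generators of a free module. -/
noncomputable def freeGen {n : ℕ} (d : Fin n → Deg r) (i : Fin n) : (freeMod K d).obj (d i) :=
  (Finsupp.single ⟨i, le_rfl⟩ 1 : {j : Fin n // d j ≤ d i} →₀ K)

theorem push_freeGen {n : ℕ} (d : Fin n → Deg r) {a : Deg r} (i : {i : Fin n // d i ≤ a}) :
    push (freeMod K d) i.2 (freeGen d i.1) =
      (Finsupp.single i 1 : {i : Fin n // d i ≤ a} →₀ K) :=
  Finsupp.mapDomain_single

/-- The morphism out of a free module given by the images of the generators. -/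
noncomputable def freeDesc {M : PersMod K r} {n : ℕ} (d : Fin n → Deg r)
    (m : ∀ i, M.obj (d i)) : freeMod K d ⟶ M where
  app a := ModuleCat.ofHom
    (Finsupp.linearCombination K fun i : {i : Fin n // d i ≤ a} => push M i.2 (m i.1))
  naturality a b f := by
    apply ModuleCat.hom_ext
    refine Finsupp.lhom_ext fun i c => ?_
    change Finsupp.linearCombination K (fun i : {i : Fin n // d i ≤ b} => push M i.2 (m i.1))
      (Finsupp.mapDomain _ (Finsupp.single i c)) = push M (leOfHom f)
        (Finsupp.linearCombination K (fun i : {i : Fin n // d i ≤ a} => push M i.2 (m i.1))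
          (Finsupp.single i c))
    rw [Finsupp.mapDomain_single, Finsupp.linearCombination_single,
      Finsupp.linearCombination_single, map_smul, push_push]

theorem range_freeDesc {M : PersMod K r} {n : ℕ} (d : Fin n → Deg r) (m : ∀ i, M.obj (d i))
    (a : Deg r) : LinearMap.range ((freeDesc d m).app a).hom = (GrSub.generated M d m).comp a := by
  rw [generated_comp]
  exact Finsupp.range_linearCombination K

/-- A morphism out of a free module is determined by its values on the generators. -/
theorem generated_eq_top_of_surjective {M : PersMod K r} {n : ℕ} {d : Fin n → Deg r}
    (p : freeMod K d ⟶ M) (hp : ∀ a, Function.Surjective (p.app a)) (a : Deg r) :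
    (GrSub.generated M d fun i => p.app (d i) (freeGen d i)).comp a = ⊤ := by
  suffices h : p = freeDesc d fun i => p.app (d i) (freeGen d i) by
    rw [← range_freeDesc, ← h]
    exact LinearMap.range_eq_top.2 (hp a)
  refine NatTrans.ext (funext fun b => ModuleCat.hom_ext ?_)
  refine Finsupp.lhom_ext' fun i => LinearMap.ext_ring ?_
  change p.app b (Finsupp.single i 1 : {i : Fin n // d i ≤ b} →₀ K) =
    Finsupp.linearCombination K (fun i : {i : Fin n // d i ≤ b} => push M i.2 _)
      (Finsupp.single i 1)
  rw [Finsupp.linearCombination_single, one_smul, ← app_push, push_freeGen]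

theorem betti₀_le {M : PersMod K r} {n : ℕ} {d : Fin n → Deg r} (p : freeMod K d ⟶ M)
    (hp : ∀ a, Function.Surjective (p.app a)) : betti₀ M ≤ n :=
  Nat.sInf_le ⟨d, p, hp⟩

theorem IsTame.exists_surjective {M : PersMod K r} (hM : IsTame M) :
    ∃ (d : Fin (betti₀ M) → Deg r) (p : freeMod K d ⟶ M), ∀ a, Function.Surjective (p.app a) := by
  obtain ⟨m, n, e, d, q, p, h⟩ := hM
  exact Nat.sInf_mem (s := {n : ℕ | ∃ (d : Fin n → Deg r) (p : freeMod K d ⟶ M),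
    ∀ a : Deg r, Function.Surjective (p.app a)}) ⟨n, d, p, fun a => (h a).2⟩

theorem shiftZero_quotient_iff {M : PersMod K r} (S : GrSub M) (w : Deg r) :
    ShiftZero w S.quotient ↔
      ∀ (a : Deg r) (x : M.obj a), push M (Deg.le_add a w) x ∈ S.comp (a + w) := by
  refine forall_congr' fun a => ?_
  rw [map_eq_zero_iff_push]
  refine ⟨fun h x => ?_, fun h x => ?_⟩
  · exact (Submodule.Quotient.mk_eq_zero _).1 (h (Submodule.Quotient.mk x))
  · obtain ⟨x, rfl⟩ := Submodule.Quotient.mk_surjective _ x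
    exact (Submodule.Quotient.mk_eq_zero _).2 (h x)

/-! ### Modules that are constant on the cells of a finite grid -/

/-- `a` and `b` lie in the same cell of the grid spanned by the coordinates of the points of `A`. -/
def SameCell (A : Finset (Deg r)) (a b : Deg r) : Prop :=
  ∀ s ∈ A, ∀ i, s i ≤ a i ↔ s i ≤ b i

theorem SameCell.mono {A B : Finset (Deg r)} (h : A ⊆ B) {a b : Deg r} (hB : SameCell B a b) :
    SameCell A a b :=
  fun s hs => hB s (h hs)

theorem SameCell.le_iff {A : Finset (Deg r)} {a b : Deg r} (h : SameCell A a b) {s : Deg r}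
    (hs : s ∈ A) : s ≤ a ↔ s ≤ b :=
  forall_congr' (h s hs)

open Classical in
/-- The smallest point of the cell of `a`. -/
noncomputable def gridFloor (A : Finset (Deg r)) (a : Deg r) : Deg r :=
  fun i => A.sup fun s => if s i ≤ a i then s i else 0

theorem gridFloor_le (A : Finset (Deg r)) (a : Deg r) : gridFloor A a ≤ a := fun i =>
  Finset.sup_le fun s _ => by
    split_ifs with h
    · exact h
    · exact zero_le

theorem sameCell_gridFloor (A : Finset (Deg r)) (a : Deg r) : SameCell A (gridFloor A a) a := by
  refine fun s hs i => ⟨fun h => h.trans (gridFloor_le A a i), fun h => ?_⟩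
  have := Finset.le_sup (f := fun s : Deg r => if s i ≤ a i then s i else 0) hs
  simp only [if_pos h] at this
  exact this

theorem SameCell.gridFloor_eq {A : Finset (Deg r)} {a b : Deg r} (h : SameCell A a b) :
    gridFloor A a = gridFloor A b :=
  funext fun i => Finset.sup_congr rfl fun s hs => by simp only [h s hs i]

/-- A finite supremum in a linear order is attained or is the bottom, so each coordinate of a floor
is `0` or a coordinate of a point of `A`. -/
theorem finite_range_gridFloor (A : Finset (Deg r)) : (Set.range (gridFloor A)).Finite := by
  classical
  let t : Fin r → Set ℝ≥0 := fun i => insert 0 ((fun s : Deg r => s i) '' (A : Set (Deg r)))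
  have ht : (Set.univ.pi t).Finite :=
    Set.Finite.pi fun i => (A.finite_toSet.image _).insert 0
  refine ht.subset ?_
  rintro _ ⟨a, rfl⟩ i -
  refine Finset.sup_induction (p := fun x => x ∈ t i) (Set.mem_insert _ _) ?_ ?_
  · intro x hx y hy
    rcases le_total x y with h | h
    · rwa [sup_eq_right.2 h]
    · rwa [sup_eq_left.2 h]
  · intro s hs
    split_ifs
    · exact Set.mem_insert_of_mem _ ⟨s, hs, rfl⟩
    · exact Set.mem_insert _ _

/-- `M` is constant on the cells of the grid spanned by `A`. -/
def GridConst (A : Finset (Deg r)) (M : PersMod K r) : Prop :=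
  ∀ (a b : Deg r) (h : a ≤ b), SameCell A a b → Function.Bijective (push M h)

theorem GridConst.mono {A B : Finset (Deg r)} (h : A ⊆ B) {M : PersMod K r}
    (hM : GridConst A M) : GridConst B M :=
  fun a b hab hc => hM a b hab (hc.mono h)

theorem gridConst_freeMod {A : Finset (Deg r)} {n : ℕ} {d : Fin n → Deg r} (hd : ∀ i, d i ∈ A) :
    GridConst A (freeMod K d) := by
  intro a b h hc
  let e : {i : Fin n // d i ≤ a} ≃ {i : Fin n // d i ≤ b} :=
    Equiv.subtypeEquivRight fun i => hc.le_iff (hd i)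
  have he : ⇑(push (freeMod K d) h) = ⇑(Finsupp.domLCongr (R := K) (M := K) e) :=
    funext fun x => (Finsupp.equivMapDomain_eq_mapDomain e x).symm
  rw [he]
  exact (Finsupp.domLCongr (R := K) (M := K) e).bijective

/-- The five-lemma chase for the structure map between two degrees of one cell. -/
theorem gridConst_of_exact_right {A : Finset (Deg r)} {X Y Z : PersMod K r} (f : X ⟶ Y)
    (g : Y ⟶ Z) (hfg : ∀ a, Function.Exact (f.app a) (g.app a))
    (hg : ∀ a, Function.Surjective (g.app a)) (hX : GridConst A X) (hY : GridConst A Y) :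
    GridConst A Z := by
  intro a b h hc
  constructor
  · rw [injective_iff_map_eq_zero]
    intro z hz
    obtain ⟨y, rfl⟩ := hg a z
    rw [← app_push] at hz
    obtain ⟨x, hx⟩ := (hfg b _).1 hz
    obtain ⟨x, rfl⟩ := (hX a b h hc).2 x
    rw [app_push] at hx
    exact (hfg a _).2 ⟨x, (hY a b h hc).1 hx⟩
  · intro z
    obtain ⟨y, rfl⟩ := hg b z
    obtain ⟨y, rfl⟩ := (hY a b h hc).2 y
    exact ⟨_, (app_push g h y).symm⟩

theorem gridConst_of_exact_left {A : Finset (Deg r)} {X Y Z : PersMod K r} (f : X ⟶ Y)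
    (g : Y ⟶ Z) (hfg : ∀ a, Function.Exact (f.app a) (g.app a))
    (hf : ∀ a, Function.Injective (f.app a)) (hY : GridConst A Y) (hZ : GridConst A Z) :
    GridConst A X := by
  intro a b h hc
  constructor
  · intro x y hxy
    apply hf a
    apply (hY a b h hc).1
    rw [← app_push, ← app_push, hxy]
  · intro x
    obtain ⟨y, hy⟩ := (hY a b h hc).2 (f.app b x)
    have : g.app a y = 0 := by
      apply (hZ a b h hc).1
      rw [← app_push, hy, map_zero]
      exact (hfg b _).2 ⟨x, rfl⟩
    obtain ⟨x', rfl⟩ := (hfg a _).1 this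
    exact ⟨x', hf b (by rw [app_push, hy])⟩

/-! ### Tameness -/

/-- Each value is pushed forward isomorphically from the floor of its cell, so finite generating
sets at the finitely many floors suffice. -/
theorem exists_surjective_freeMod {A : Finset (Deg r)} {M : PersMod K r} (hM : GridConst A M)
    (hfin : ∀ a, Module.Finite K (M.obj a)) :
    ∃ (n : ℕ) (d : Fin n → Deg r) (p : freeMod K d ⟶ M), ∀ a, Function.Surjective (p.app a) := by
  choose G hG using fun a => (hfin a).fg_top
  have hT : (⋃ a ∈ Set.range (gridFloor A), (Sigma.mk a) '' (G a : Set (M.obj a))).Finite :=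
    (finite_range_gridFloor A).biUnion fun a _ => (G a).finite_toSet.image _
  obtain ⟨n, x, hx⟩ := hT.fin_param
  refine ⟨n, fun i => (x i).1, freeDesc _ fun i => (x i).2, fun a => ?_⟩
  have key : (GrSub.generated M (fun i => (x i).1) fun i => (x i).2).comp (gridFloor A a) = ⊤ := by
    rw [eq_top_iff, ← hG, Submodule.span_le]
    intro y hy
    have : (⟨gridFloor A a, y⟩ : Σ a, M.obj a) ∈ Set.range x := by
      rw [hx.2]
      exact Set.mem_biUnion ⟨a, rfl⟩ ⟨y, hy, rfl⟩
    obtain ⟨i, hi⟩ := this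
    have h1 := push_mem_generated M (fun i => (x i).1) (fun i => (x i).2) i le_rfl
    rw [push_self] at h1
    rw [hi] at h1
    exact h1
  suffices h : LinearMap.range ((freeDesc (fun i => (x i).1) fun i => (x i).2).app a).hom = ⊤ from
    LinearMap.range_eq_top.1 h
  rw [range_freeDesc, eq_top_iff]
  rintro y -
  obtain ⟨y, rfl⟩ := (hM _ a (gridFloor_le A a) (sameCell_gridFloor A a)).2 y
  exact GrSub.push_mem _ _ (key ▸ Submodule.mem_top)

theorem finite_freeMod_obj {n : ℕ} (d : Fin n → Deg r) (a : Deg r) :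
    Module.Finite K ((freeMod K d).obj a) :=
  inferInstanceAs (Module.Finite K ({i : Fin n // d i ≤ a} →₀ K))

theorem finite_kernel_obj {M N : PersMod K r} (f : M ⟶ N) (a : Deg r)
    (h : Module.Finite K (M.obj a)) : Module.Finite K ((Limits.kernel f).obj a) :=
  Module.Finite.of_injective ((Limits.kernel.ι f).app a).hom (kernel_ι_app_injective f a)

theorem finite_cokernel_obj {M N : PersMod K r} (f : M ⟶ N) (a : Deg r)
    (h : Module.Finite K (N.obj a)) : Module.Finite K ((Limits.cokernel f).obj a) :=
  Module.Finite.of_surjective ((Limits.cokernel.π f).app a).hom (cokernel_π_app_surjective f a)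

theorem GridConst.kernel {A : Finset (Deg r)} {M N : PersMod K r} (f : M ⟶ N)
    (hM : GridConst A M) (hN : GridConst A N) : GridConst A (Limits.kernel f) :=
  gridConst_of_exact_left _ f (kernel_ι_app_exact f) (kernel_ι_app_injective f) hM hN

theorem GridConst.cokernel {A : Finset (Deg r)} {M N : PersMod K r} (f : M ⟶ N)
    (hM : GridConst A M) (hN : GridConst A N) : GridConst A (Limits.cokernel f) :=
  gridConst_of_exact_right f _ (cokernel_π_app_exact f) (cokernel_π_app_surjective f) hM hN

theorem isTame_iff_gridConst {M : PersMod K r} :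
    IsTame M ↔ (∃ A, GridConst A M) ∧ ∀ a, Module.Finite K (M.obj a) := by
  classical
  constructor
  · rintro ⟨m, n, e, d, q, p, h⟩
    refine ⟨⟨Finset.univ.image e ∪ Finset.univ.image d,
      gridConst_of_exact_right q p (fun a => (h a).1) (fun a => (h a).2)
        (gridConst_freeMod fun i => by simp) (gridConst_freeMod fun i => by simp)⟩, fun a => ?_⟩
    have := finite_freeMod_obj (K := K) d a
    exact Module.Finite.of_surjective (p.app a).hom (h a).2
  · rintro ⟨⟨A, hA⟩, hfin⟩
    obtain ⟨n, d, p, hp⟩ := exists_surjective_freeMod hA hfin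
    -- Relations: the kernel of the cover is again constant on cells, once the generator degrees
    -- join the grid, so it too has a finite free cover.
    have hker : GridConst (A ∪ Finset.univ.image d) (Limits.kernel p) :=
      GridConst.kernel p (gridConst_freeMod fun i => by simp) (hA.mono Finset.subset_union_left)
    obtain ⟨m, e, q, hq⟩ := exists_surjective_freeMod hker
      fun a => finite_kernel_obj p a (finite_freeMod_obj d a)
    refine ⟨m, n, e, d, q ≫ Limits.kernel.ι p, p, fun a => ⟨fun y => ?_, hp a⟩⟩
    rw [kernel_ι_app_exact p a y]
    constructor
    · rintro ⟨x, rfl⟩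
      obtain ⟨w, rfl⟩ := hq a x
      exact ⟨w, rfl⟩
    · rintro ⟨w, rfl⟩
      exact ⟨q.app a w, rfl⟩

theorem isTame_freeMod {n : ℕ} (d : Fin n → Deg r) : IsTame (freeMod K d) := by
  classical
  exact isTame_iff_gridConst.2 ⟨⟨Finset.univ.image d, gridConst_freeMod fun i => by simp⟩,
    finite_freeMod_obj d⟩

theorem IsTame.kernel {M N : PersMod K r} (hM : IsTame M) (hN : IsTame N) (f : M ⟶ N) :
    IsTame (Limits.kernel f) := by
  classical
  rw [isTame_iff_gridConst] at *
  obtain ⟨⟨A, hA⟩, hfin⟩ := hM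
  obtain ⟨⟨B, hB⟩, -⟩ := hN
  exact ⟨⟨A ∪ B, GridConst.kernel f (hA.mono Finset.subset_union_left)
    (hB.mono Finset.subset_union_right)⟩, fun a => finite_kernel_obj f a (hfin a)⟩

theorem IsTame.cokernel {M N : PersMod K r} (hM : IsTame M) (hN : IsTame N) (f : M ⟶ N) :
    IsTame (Limits.cokernel f) := by
  classical
  rw [isTame_iff_gridConst] at *
  obtain ⟨⟨A, hA⟩, -⟩ := hM
  obtain ⟨⟨B, hB⟩, hfin⟩ := hN
  exact ⟨⟨A ∪ B, GridConst.cokernel f (hA.mono Finset.subset_union_left)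
    (hB.mono Finset.subset_union_right)⟩, fun a => finite_cokernel_obj f a (hfin a)⟩

/-! ### Right continuity of the shift-dimension -/

/-- Thresholds already reached at `δ` stay reached as `ε` grows; those not yet reached are missed
strictly, hence by continuity also for `ε` near `δ`. This fails to the left of `δ`. -/
theorem eventually_sameCell (A : Finset (Deg r)) (v t : Deg r) (δ : ℝ≥0) :
    ∀ᶠ ε in nhdsWithin δ (Set.Ioi δ), SameCell A (t + δ • v) (t + ε • v) := by
  simp only [SameCell]
  rw [Finset.eventually_all]
  intro s _
  rw [Filter.eventually_all]
  intro i
  by_cases h : s i ≤ (t + δ • v) i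
  · filter_upwards [self_mem_nhdsWithin] with ε hε
    refine ⟨fun _ => h.trans ?_, fun _ => h⟩
    exact add_le_add le_rfl (mul_le_mul_left (le_of_lt hε) (v i))
  · have hc : Continuous fun ε : ℝ≥0 => t i + ε * v i := by fun_prop
    have := (hc.tendsto δ).eventually_lt_const (not_le.1 h)
    filter_upwards [nhdsWithin_le_nhds this] with ε hε
    exact ⟨fun h' => absurd h' h, fun h' => absurd h' (not_le.2 hε)⟩

theorem exists_gt_sameCell (A : Finset (Deg r)) (v : Deg r) (δ : ℝ≥0) :
    ∃ ε > δ, ∀ a, SameCell A (gridFloor A a + δ • v) (gridFloor A a + ε • v) := by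
  have h : ∀ᶠ ε in nhdsWithin δ (Set.Ioi δ), ∀ t ∈ Set.range (gridFloor A),
      SameCell A (t + δ • v) (t + ε • v) :=
    (Filter.eventually_all_finite (finite_range_gridFloor A)).2
      fun t _ => eventually_sameCell A v t δ
  obtain ⟨ε, hε, h'⟩ := (h.and self_mem_nhdsWithin).exists
  exact ⟨ε, h', fun a => hε _ ⟨a, rfl⟩⟩

theorem smul_le_smul_deg {ε τ : ℝ≥0} (h : ε ≤ τ) (v : Deg r) : ε • v ≤ τ • v :=
  fun i => mul_le_mul_left h (v i)

theorem add_le_add_deg {a b c d : Deg r} (h : a ≤ b) (h' : c ≤ d) : a + c ≤ b + d :=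
  fun i => add_le_add (h i) (h' i)

theorem ShiftZero.of_le {M : PersMod K r} {w w' : Deg r} (h : w ≤ w') (hw : ShiftZero w M) :
    ShiftZero w' M := by
  intro a
  rw [map_eq_zero_iff_push]
  intro x
  rw [← push_push M (Deg.le_add a w) (add_le_add_deg le_rfl h),
    (map_eq_zero_iff_push M _).1 (hw a), map_zero]

/-- Choose `ε > δ` so close that both shifts send every floor into the same cell, and move the
generators down to the floors of their own cells. -/
theorem shiftDim_le_of_forall_gt {A : Finset (Deg r)} {M : PersMod K r} (hM : GridConst A M)
    (v : Deg r) (δ : ℝ≥0) (k : ℕ)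
    (hk : ∀ ε > δ, ∃ (d : Fin k → Deg r) (m : ∀ i, M.obj (d i)),
      ShiftZero (ε • v) (GrSub.generated M d m).quotient) :
    shiftDim (δ • v) M ≤ k := by
  obtain ⟨ε, hε, hcell⟩ := exists_gt_sameCell A v δ
  obtain ⟨d, m, hm⟩ := hk ε hε
  rw [shiftZero_quotient_iff] at hm
  choose m' hm' using fun i =>
    (hM _ (d i) (gridFloor_le A (d i)) (sameCell_gridFloor A (d i))).2 (m i)
  refine Nat.sInf_le ⟨fun i => gridFloor A (d i), m', ?_⟩
  rw [shiftZero_quotient_iff]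
  have key (t : Deg r) (ht : SameCell A (t + δ • v) (t + ε • v)) (x : M.obj t) :
      push M (Deg.le_add t (δ • v)) x ∈
        (GrSub.generated M (fun i => gridFloor A (d i)) m').comp (t + δ • v) := by
    have hle : t + δ • v ≤ t + ε • v := add_le_add_deg le_rfl (smul_le_smul_deg hε.le v)
    have hbij := hM _ _ hle ht
    have h1 : (GrSub.generated M d m).comp (t + ε • v) ≤
        ((GrSub.generated M (fun i => gridFloor A (d i)) m').comp (t + δ • v)).map
          (push M hle) := by
      rw [generated_comp, Submodule.span_le]
      rintro _ ⟨⟨i, hi⟩, rfl⟩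
      -- The floor is monotone, and `t + ε • v` has the same floor as `t + δ • v`; so the lowered
      -- generator already acts at `t + δ • v`.
      have hi' : gridFloor A (d i) ≤ t + δ • v := by
        have : gridFloor A (d i) ≤ gridFloor A (t + ε • v) := fun j =>
          Finset.sup_mono_fun fun s _ => by
            by_cases h : s j ≤ d i j
            · rw [if_pos h, if_pos (h.trans (hi j))]
            · rw [if_neg h]; exact zero_le
        rw [← ht.gridFloor_eq] at this
        exact this.trans (gridFloor_le _ _)
      refine ⟨_, push_mem_generated M _ m' i hi', ?_⟩
      rw [push_push]
      dsimp only
      rw [← hm', push_push]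
    obtain ⟨y, hy, hyx⟩ := h1 (hm t x)
    rw [← push_push M (Deg.le_add t (δ • v)) hle] at hyx
    rwa [← hbij.1 hyx]
  intro a x
  -- Every element comes from the floor of its cell, where `key` applies.
  obtain ⟨x, rfl⟩ := (hM _ a (gridFloor_le A a) (sameCell_gridFloor A a)).2 x
  rw [push_push, ← push_push M (Deg.le_add (gridFloor A a) (δ • v))
    (add_le_add_deg (gridFloor_le A a) le_rfl)]
  exact GrSub.push_mem _ _ (key _ (hcell a) x)

/-! ### The quotient by the degrees above `α` -/

/-- The projection of a persistence module onto a quotient. -/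
noncomputable def GrSub.mkQ {M : PersMod K r} (S : GrSub M) : M ⟶ S.quotient where
  app a := ModuleCat.ofHom (S.comp a).mkQ
  naturality _ _ _ := rfl

theorem GrSub.mkQ_surjective {M : PersMod K r} (S : GrSub M) (a : Deg r) :
    Function.Surjective (S.mkQ.app a) :=
  Submodule.mkQ_surjective _

theorem GrSub.mkQ_eq_zero {M : PersMod K r} (S : GrSub M) {a : Deg r} {x : M.obj a} :
    S.mkQ.app a x = 0 ↔ x ∈ S.comp a :=
  Submodule.Quotient.mk_eq_zero _

theorem above_comp_of_le (M : PersMod K r) {α a : Deg r} (h : α ≤ a) :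
    (GrSub.above M α).comp a = ⊤ :=
  iSup_pos h

theorem above_comp_of_not_le (M : PersMod K r) {α a : Deg r} (h : ¬ α ≤ a) :
    (GrSub.above M α).comp a = ⊥ :=
  iSup_neg h

theorem above_quotient_eq_zero (M : PersMod K r) {α a : Deg r} (h : α ≤ a)
    (x : (GrSub.above M α).quotient.obj a) : x = 0 := by
  obtain ⟨x, rfl⟩ := GrSub.mkQ_surjective _ a x
  exact (GrSub.mkQ_eq_zero _).2 (above_comp_of_le M h ▸ Submodule.mem_top)

/-- With `α` in the grid, a cell lies entirely above `α` or contains no point above it, so the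
quotient is either zero or unchanged on it. -/
theorem gridConst_above_quotient {A : Finset (Deg r)} {M : PersMod K r} (hM : GridConst A M)
    {α : Deg r} (hα : α ∈ A) : GridConst A (GrSub.above M α).quotient := by
  intro a b h hc
  constructor
  · rw [injective_iff_map_eq_zero]
    intro x hx
    by_cases hb : α ≤ b
    · exact above_quotient_eq_zero M ((hc.le_iff hα).2 hb) x
    · obtain ⟨x, rfl⟩ := GrSub.mkQ_surjective _ a x
      rw [← app_push, GrSub.mkQ_eq_zero, above_comp_of_not_le M hb, Submodule.mem_bot] at hx
      rw [(hM a b h hc).1 (hx.trans (map_zero _).symm), map_zero]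
  · intro x
    obtain ⟨x, rfl⟩ := GrSub.mkQ_surjective _ b x
    obtain ⟨x, rfl⟩ := (hM a b h hc).2 x
    exact ⟨_, (app_push _ h x).symm⟩

theorem comp_generated_app {M N : PersMod K r} (f : M ⟶ N) {k : ℕ} (d : Fin k → Deg r)
    (m : ∀ i, M.obj (d i)) (a : Deg r) :
    (GrSub.generated N d fun i => f.app (d i) (m i)).comp a =
      ((GrSub.generated M d m).comp a).map (f.app a).hom := by
  rw [generated_comp, generated_comp, Submodule.map_span, ← Set.range_comp]
  congr 2
  funext i
  exact (app_push f i.2 (m i.1)).symm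

/-- Generators of `M / ⨁_{β ≥ α} M_β` up to a shift, tested on representatives in `M`. -/
theorem shiftZero_above_iff {M : PersMod K r} {α w : Deg r} {k : ℕ} (d : Fin k → Deg r)
    (m : ∀ i, M.obj (d i)) :
    ShiftZero w (GrSub.generated (GrSub.above M α).quotient d
        fun i => (GrSub.above M α).mkQ.app (d i) (m i)).quotient ↔
      ∀ (a : Deg r) (x : M.obj a), ¬ α ≤ a + w →
        push M (Deg.le_add a w) x ∈ (GrSub.generated M d m).comp (a + w) := by
  rw [shiftZero_quotient_iff]
  refine forall_congr' fun a => ?_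
  constructor
  · intro h x hα
    have hx := h ((GrSub.above M α).mkQ.app a x)
    rw [← app_push, comp_generated_app] at hx
    obtain ⟨y, hy, hyx⟩ := hx
    -- Outside the degrees above `α` the projection is injective.
    rw [← sub_eq_zero] at hyx
    erw [← map_sub] at hyx
    erw [GrSub.mkQ_eq_zero] at hyx
    rw [above_comp_of_not_le M hα, Submodule.mem_bot, sub_eq_zero] at hyx
    rwa [← hyx]
  · intro h x
    by_cases hα : α ≤ a + w
    · rw [above_quotient_eq_zero M hα (push _ _ x)]
      exact Submodule.zero_mem _
    · obtain ⟨x, rfl⟩ := GrSub.mkQ_surjective _ a x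
      rw [← app_push, comp_generated_app]
      exact ⟨_, h x hα, rfl⟩

/-! ### The truncated standard noise -/

open Classical in
theorem mem_truncate_noise_iff {v α : Deg r} {ε : ℝ≥0} {N : PersMod K r} :
    N ∈ ((standardContour v).truncate α).noise K ε ↔
      IsTame N ∧ ∀ (a : Deg r) (x : N.obj a), ¬ α ≤ a + ε • v →
        push N (Deg.le_add a (ε • v)) x = 0 := by
  refine and_congr_right fun _ => ?_
  have e (a : Deg r) : ((standardContour v).truncate α).toFun a ε =
      if ¬ (α : WithTop (Deg r)) ≤ (a + ε • v : Deg r) then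
        ((a + ε • v : Deg r) : WithTop (Deg r)) else ⊤ := rfl
  constructor
  · intro h a x hα
    refine (map_eq_zero_iff_push N _).1 (h a _ (Deg.le_add a _) ?_) x
    rw [e, if_pos (by rwa [WithTop.coe_le_coe])]
  · intro h a b hab hb
    rw [e] at hb
    by_cases hα : (α : WithTop (Deg r)) ≤ (a + ε • v : Deg r)
    · rw [if_neg (not_not.2 hα)] at hb
      exact absurd hb WithTop.top_ne_coe
    rw [if_pos hα] at hb
    obtain rfl := WithTop.coe_injective hb
    rw [map_eq_zero_iff_push]
    exact fun x => h a x (by rwa [WithTop.coe_le_coe] at hα)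

theorem mem_truncate_noise_of_subsingleton {v α : Deg r} {ε : ℝ≥0} {N : PersMod K r}
    (hN : IsTame N) (h : ∀ (a : Deg r) (x : N.obj a), x = 0) :
    N ∈ ((standardContour v).truncate α).noise K ε :=
  mem_truncate_noise_iff.2 ⟨hN, fun _ _ _ => h _ _⟩

theorem kernel_eq_zero_of_injective {M N : PersMod K r} (f : M ⟶ N) {a : Deg r}
    (hf : Function.Injective (f.app a)) (x : (Limits.kernel f).obj a) : x = 0 := by
  apply kernel_ι_app_injective f a
  apply hf
  rw [(kernel_ι_app_exact f a _).2 ⟨x, rfl⟩, map_zero, map_zero]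

theorem cokernel_eq_zero_of_surjective {M N : PersMod K r} (f : M ⟶ N) {a : Deg r}
    (hf : Function.Surjective (f.app a)) (x : (Limits.cokernel f).obj a) : x = 0 := by
  obtain ⟨y, rfl⟩ := cokernel_π_app_surjective f a x
  exact (cokernel_π_app_exact f a y).2 (hf y)

/-- If `M` and `N` are `ε`-close for the truncated noise, then `β₀(N)` elements of `M` generate
`M / ⨁_{β ≥ α} M_β` up to the shift by `ε v`. -/
theorem NoiseClose.exists_shiftZero {v α : Deg r} {ε : ℝ≥0} {M N : TameMod K r}
    (h : NoiseClose (((standardContour v).truncate α).noise K) ε M N) :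
    ∃ (d : Fin (betti₀ N.1) → Deg r) (m : ∀ i, (GrSub.above M.1 α).quotient.obj (d i)),
      ShiftZero (ε • v) (GrSub.generated (GrSub.above M.1 α).quotient d m).quotient := by
  obtain ⟨L, f, g, ε₁, ε₂, ⟨τ, μ, h₁, hkf, hcf⟩, ⟨τ', μ', h₂, -, hcg⟩, hε⟩ := h
  rw [mem_truncate_noise_iff] at hkf hcf hcg
  obtain ⟨d, p, hp⟩ := N.2.exists_surjective
  set n : ∀ i, N.1.obj (d i) := fun i => p.app (d i) (freeGen d i)
  have hn := generated_eq_top_of_surjective p hp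
  -- Vanishing of the shift on the cokernel says that shifted elements of `L` lie in the image.
  have lift {X : PersMod K r} (φ : X ⟶ L.1) {ρ : ℝ≥0}
      (hc : ∀ (a : Deg r) (x : (Limits.cokernel φ).obj a), ¬ α ≤ a + ρ • v →
        push (Limits.cokernel φ) (Deg.le_add a (ρ • v)) x = 0)
      {a : Deg r} (y : L.1.obj a) (ha : ¬ α ≤ a + ρ • v) :
      ∃ x, φ.app _ x = push L.1 (Deg.le_add a (ρ • v)) y := by
    refine (cokernel_π_app_exact φ _ _).1 ?_
    rw [app_push]
    exact hc a _ ha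
  have hm : ∀ i, ∃ x : M.1.obj (d i + μ • v), ¬ α ≤ d i + μ • v →
      f.app _ x = push L.1 (Deg.le_add _ (μ • v)) (g.app _ (n i)) := by
    intro i
    by_cases hi : α ≤ d i + μ • v
    -- A default value: no lift is available here, and such a generator never contributes in degrees
    -- not above `α`.
    · exact ⟨0, fun h => absurd hi h⟩
    · obtain ⟨x, hx⟩ := lift f hcf.2 (g.app _ (n i)) hi
      exact ⟨x, fun _ => hx⟩
  choose m hm using hm
  refine ⟨fun i => d i + μ • v, fun i => (GrSub.above M.1 α).mkQ.app _ (m i), ?_⟩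
  -- The shift is spent as `μ'` to lift `f x` to `N`, `μ` to lift the generators back to `M`, and
  -- `τ` to kill the error in the kernel of `f`.
  have hsum : μ' • v + μ • v + τ • v ≤ ε • v := by
    rw [← add_smul, ← add_smul]
    refine smul_le_smul_deg (le_trans ?_ hε) v
    calc μ' + μ + τ = (τ + μ) + μ' := by ring
      _ ≤ ε₁ + ε₂ := add_le_add h₁ (le_trans le_add_self h₂)
  refine ShiftZero.of_le hsum ((shiftZero_above_iff _ m).2 ?_)
  intro a x hα
  rw [← add_assoc, ← add_assoc] at hα
  have h2 : ¬ α ≤ a + μ' • v + μ • v := fun h => hα (h.trans (Deg.le_add _ _))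
  have h1 : ¬ α ≤ a + μ' • v := fun h => h2 (h.trans (Deg.le_add _ _))
  obtain ⟨y, hy⟩ := lift g hcg.2 (f.app a x) h1
  -- Linear combinations of the generators of `N` return to combinations of the `m i`.
  have hgen (z : N.1.obj (a + μ' • v)) :
      ∃ u ∈ (GrSub.generated M.1 (fun i => d i + μ • v) m).comp (a + μ' • v + μ • v),
        f.app _ u = push L.1 (Deg.le_add _ (μ • v)) (g.app _ z) := by
    have hz : z ∈ (GrSub.generated N.1 d n).comp (a + μ' • v) := hn _ ▸ Submodule.mem_top
    rw [generated_comp] at hz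
    induction hz using Submodule.span_induction with
    | mem z hz =>
      obtain ⟨⟨i, hi⟩, rfl⟩ := hz
      have hi' : d i + μ • v ≤ a + μ' • v + μ • v := add_le_add_deg hi le_rfl
      refine ⟨_, push_mem_generated M.1 _ m i hi', ?_⟩
      rw [app_push, hm i fun h => h2 (h.trans hi'), app_push, push_push, push_push]
    | zero => exact ⟨0, Submodule.zero_mem _, by simp⟩
    | add z w _ _ hz hw =>
      obtain ⟨s, hs, hs'⟩ := hz
      obtain ⟨t, ht, ht'⟩ := hw
      exact ⟨s + t, Submodule.add_mem _ hs ht, by simp only [map_add, hs', ht']⟩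
    | smul c z _ hz =>
      obtain ⟨s, hs, hs'⟩ := hz
      exact ⟨c • s, Submodule.smul_mem _ c hs, by simp only [map_smul, hs']⟩
  obtain ⟨u, hu, hfu⟩ := hgen y
  rw [hy, push_push, ← app_push] at hfu
  have hle : a ≤ a + μ' • v + μ • v := (Deg.le_add _ _).trans (Deg.le_add _ _)
  -- The error committed by replacing the shifted `x` by `u`.
  have h0 : f.app _ (push M.1 hle x - u) = 0 := by
    rw [map_sub, hfu, sub_self]
  obtain ⟨w, hw⟩ := (kernel_ι_app_exact f _ _).1 h0
  have h3 := congrArg (push M.1 (Deg.le_add _ (τ • v))) hw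
  rw [← app_push, hkf.2 _ w hα, map_zero, map_sub, push_push, eq_comm, sub_eq_zero] at h3
  have h4 := GrSub.push_mem _ (Deg.le_add _ (τ • v)) hu
  rw [← h3] at h4
  have hend : a + μ' • v + μ • v + τ • v ≤ a + (μ' • v + μ • v + τ • v) := by
    simp only [add_assoc, le_refl]
  have h5 := GrSub.push_mem _ hend h4
  rwa [push_push] at h5

/-- If `M / ⨁_{β ≥ α} M_β` is generated by `k` elements up to the shift by `δ v`, then `M` is
`δ`-close to a tame module generated by `k` elements. -/
theorem exists_noiseClose {v α : Deg r} {δ : ℝ≥0} (M : TameMod K r) {k : ℕ}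
    (d : Fin k → Deg r) (m : ∀ i, (GrSub.above M.1 α).quotient.obj (d i))
    (hm : ShiftZero (δ • v) (GrSub.generated (GrSub.above M.1 α).quotient d m).quotient) :
    ∃ N : TameMod K r, NoiseClose (((standardContour v).truncate α).noise K) δ M N ∧
      betti₀ N.1 ≤ k := by
  choose m' hm' using fun i => (GrSub.above M.1 α).mkQ_surjective (d i) (m i)
  obtain rfl : (fun i => (GrSub.above M.1 α).mkQ.app (d i) (m' i)) = m := funext hm'
  rw [shiftZero_above_iff] at hm
  set φ : freeMod K d ⟶ M.1 := freeDesc d m'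
  set ψ := Limits.cokernel.π φ
  have hcoker : IsTame (Limits.cokernel φ) := (isTame_freeMod d).cokernel M.2 φ
  -- The submodule generated by the lifts is the image of `φ`, taken as the kernel of its cokernel
  -- projection so that tameness is inherited.
  set ι := Limits.kernel.ι ψ
  have hι : IsTame (Limits.kernel ψ) := M.2.kernel hcoker ψ
  -- The cospan is `M = M ← N`; all of `δ` goes to the cokernel of the inclusion.
  refine ⟨⟨_, hι⟩, ⟨M, 𝟙 _, ι, 0, δ, ⟨0, 0, by simp, ?_, ?_⟩, ⟨0, δ, by simp, ?_, ?_⟩, by simp⟩,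
    betti₀_le (Limits.kernel.lift ψ φ (Limits.cokernel.condition φ)) fun a x => ?_⟩
  · exact mem_truncate_noise_of_subsingleton (M.2.kernel M.2 _)
      fun a => kernel_eq_zero_of_injective _ Function.injective_id
  · exact mem_truncate_noise_of_subsingleton (M.2.cokernel M.2 _)
      fun a => cokernel_eq_zero_of_surjective _ Function.surjective_id
  · exact mem_truncate_noise_of_subsingleton (hι.kernel M.2 _)
      fun a => kernel_eq_zero_of_injective _ (kernel_ι_app_injective ψ a)
  · refine mem_truncate_noise_iff.2 ⟨hι.cokernel M.2 _, fun a x hα => ?_⟩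
    obtain ⟨x, rfl⟩ := cokernel_π_app_surjective ι a x
    rw [← app_push]
    refine (cokernel_π_app_exact ι _ _).2 ((kernel_ι_app_exact ψ _ _).1
      ((cokernel_π_app_exact φ _ _).2 ?_))
    have := hm a x hα
    rwa [← range_freeDesc] at this
  · obtain ⟨y, hy⟩ := (cokernel_π_app_exact φ a _).1 ((kernel_ι_app_exact ψ a _).2 ⟨x, rfl⟩)
    refine ⟨y, kernel_ι_app_injective ψ a ?_⟩
    rw [← hy]
    exact congrArg (fun χ : freeMod K d ⟶ M.1 => χ.app a y)
      (Limits.kernel.lift_ι ψ φ (Limits.cokernel.condition φ))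

theorem NoiseClose.noiseDist_le {V : ℝ≥0 → Set (PersMod K r)} {M N : TameMod K r} {ε : ℝ≥0}
    (h : NoiseClose V ε M N) : noiseDist V M N ≤ ε :=
  iInf₂_le ε h

theorem exists_noiseClose_of_noiseDist_lt {V : ℝ≥0 → Set (PersMod K r)} {M N : TameMod K r}
    {ε : ℝ≥0} (h : noiseDist V M N < ε) : ∃ ε' < ε, NoiseClose V ε' M N := by
  simp only [noiseDist, iInf_lt_iff] at h
  obtain ⟨ε', h', hlt⟩ := h
  exact ⟨ε', ENNReal.coe_lt_coe.1 hlt, h'⟩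

/-- The distance bound gives closeness only for parameters below each `ε > δ`; right continuity
closes the gap. -/
theorem shiftDim_le_betti₀ {v α : Deg r} {δ : ℝ≥0} {M N : TameMod K r}
    (h : noiseDist (((standardContour v).truncate α).noise K) M N ≤ δ) :
    shiftDim (δ • v) (GrSub.above M.1 α).quotient ≤ betti₀ N.1 := by
  classical
  obtain ⟨⟨A, hA⟩, -⟩ := isTame_iff_gridConst.1 M.2
  have hA' : GridConst (insert α A) M.1 := hA.mono (Finset.subset_insert _ _)
  refine shiftDim_le_of_forall_gt
    (gridConst_above_quotient hA' (Finset.mem_insert_self α A)) v δ _ fun ε hε => ?_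
  obtain ⟨ε', hε', hclose⟩ :=
    exists_noiseClose_of_noiseDist_lt (h.trans_lt (ENNReal.coe_lt_coe.2 hε))
  obtain ⟨d, m, hm⟩ := hclose.exists_shiftZero
  exact ⟨d, m, hm.of_le (smul_le_smul_deg hε'.le v)⟩

theorem noiseDist_truncate_self (v α : Deg r) (M : TameMod K r) :
    noiseDist (((standardContour v).truncate α).noise K) M M ≤ (0 : ℝ≥0) := by
  have h : NoiseEquivalence (((standardContour v).truncate α).noise K) 0 (𝟙 M.1) :=
    ⟨0, 0, by simp,
      mem_truncate_noise_of_subsingleton (M.2.kernel M.2 _)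
        fun a => kernel_eq_zero_of_injective _ Function.injective_id,
      mem_truncate_noise_of_subsingleton (M.2.cokernel M.2 _)
        fun a => cokernel_eq_zero_of_surjective _ Function.surjective_id⟩
  exact NoiseClose.noiseDist_le ⟨M, 𝟙 _, 𝟙 _, 0, 0, h, h, by simp⟩

theorem mainTheorem5 {K : Type u} [Field K] {r : ℕ} (v α : Deg r) (M : TameMod K r) (δ : ℝ≥0) :
    hierarchicalStabilization
        (noiseDist (((standardContour v).truncate α).noise K))
        (fun N : TameMod K r => betti₀ N.1) M δ
      = shiftDim (δ • v) (GrSub.above M.1 α).quotient := by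
  -- On `ℕ`, `sInf ∅ = 0`, so the sets on both sides must be shown nonempty for their minima to be
  -- attained; here `M` itself is a competitor.
  have hself : noiseDist (((standardContour v).truncate α).noise K) M M ≤ δ :=
    (noiseDist_truncate_self v α M).trans (ENNReal.coe_le_coe.2 zero_le)
  apply le_antisymm
  · obtain ⟨d, p, hp⟩ := M.2.exists_surjective
    have hne : ∃ (d : Fin (betti₀ M.1) → Deg r)
        (m : ∀ i, (GrSub.above M.1 α).quotient.obj (d i)),
        ShiftZero (δ • v) (GrSub.generated (GrSub.above M.1 α).quotient d m).quotient := by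
      -- Generators of `M` generate the quotient, even without a shift.
      refine ⟨d, _, (shiftZero_above_iff d fun i => p.app (d i) (freeGen d i)).2 fun a x _ => ?_⟩
      rw [generated_eq_top_of_surjective p hp]
      exact Submodule.mem_top
    obtain ⟨d, m, hm⟩ := Nat.sInf_mem (s := {k : ℕ | ∃ (d : Fin k → Deg r)
      (m : ∀ i, (GrSub.above M.1 α).quotient.obj (d i)),
      ShiftZero (δ • v) (GrSub.generated (GrSub.above M.1 α).quotient d m).quotient}) ⟨_, hne⟩
    obtain ⟨N, hN, hle⟩ := exists_noiseClose M d m hm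
    exact le_trans (Nat.sInf_le ⟨N, hN.noiseDist_le, rfl⟩) hle
  · obtain ⟨N, hN, hle⟩ := Nat.sInf_mem (s := {n : ℕ | ∃ N : TameMod K r,
      noiseDist (((standardContour v).truncate α).noise K) M N ≤ (δ : ℝ≥0∞) ∧ betti₀ N.1 = n})
      ⟨_, M, hself, rfl⟩
    exact (shiftDim_le_betti₀ hN).trans hle.le
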